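/- **Model.** Let $G$ be a finite connected simple graph with $n$ anonymous nodes; at every node $v$ the incident edges carry the distinct port numbers $0,\dots,\deg(v)-1$ (the two ends of an edge are numbered independently), and $v$ has a capacity $c(v)\in\mathbb N$, where $\sum_v c(v)\ge k$. There are $k$ robots with distinct IDs in $\mathbb N$, placed arbitrarily on the nodes. One of them is the shepherd, which every co-located robot recognizes and which is never Byzantine; at most $f$ of the other robots are strong Byzantine. The shepherd knows $n$, $k$ and its ID; every other robot knows only its own ID; the value $f$ is unknown to all robots. Memory is unlimited. Time proceeds in synchronous rounds. In each round a robot perceives the degree and the capacity of its node and the port through which it last entered, shouts one message, perceives of every other robot at its node whether it is the shepherd, the ID it shows and the message it shouts, updates its memory, and then stays, leaves through a port, or terminates (after which it never moves again). A non-Byzantine robot follows the given deterministic algorithm and shows its true ID. A strong Byzantine robot behaves arbitrarily: in each round it may show any single ID, shout any single message or none, and stay or leave through any port. *Byzantine dispersion* is achieved when all non-Byzantine robots have terminated and every node $u$ holds at most $c(u)$ non-Byzantine robots (the shepherd included). An *exploration sequence* is a finite sequence of integers $x_1,\dots,x_\ell$. A robot following it first leaves its node through port $0$; in step $i$, having entered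 the current node $u$ through port $p$, it leaves through port $(p+x_i)\bmod\deg(u)$. (On a one-node graph it stays.) This takes $\ell+1$ rounds. The sequence *explores* $G$ if, from every starting node, all nodes of $G$ are visited; it is *universal for $n$* (a UXS) if it explores every connected port-labelled graph with at most $n$ nodes. **Theorem.** For every $n$ there is a universal exploration sequence for $n$. Moreover, there is an absolute constant $C$ such that the following holds. For every choice of exploration sequences $U_n$ $(n\in\mathbb N)$, taking $X(n)$ rounds each, there is a deterministic algorithm (depending only on these sequences) such that for all $n,k,f$ with $f<\lfloor (k-1)/2\rfloor$, every connected capacitated $n$-node graph that is explored by $U_n$ (so every connected capacitated $n$-node graph, if $U_n$ is universal for $n$) and whose total capacity is at least $k$, every initial placement of $k$ robots with a trusted shepherd, and every behaviour of the at most $f$ strong Byzantine robots, the algorithm achieves Byzantine dispersion within $C\,(X(n)+n^3)$ rounds, that is, in $O(X(n)+n^3)$ rounds. -/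

import Mathlib

namespace Dispersion

/-- A finite simple graph whose nodes are anonymous and in which the edges at every node `v`
carry the distinct port numbers `0, …, deg v - 1` (the two ends of an edge are numbered
independently). -/
structure PortGraph (V : Type) where
  graph : SimpleGraph V
  deg : V → ℕ
  port : ∀ v, Fin (deg v) ≃ graph.neighborSet v

namespace PortGraph

variable {V : Type} (G : PortGraph V)

/-- The node reached from `v` through port `p`. -/
def nbr (v : V) (p : Fin (G.deg v)) : V := (G.port v p).1

theorem adj_nbr (v : V) (p : Fin (G.deg v)) : G.graph.Adj v (G.nbr v p) := (G.port v p).2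

/-- The port through which a robot enters `G.nbr v p` when it leaves `v` through port `p`. -/
def backPort (v : V) (p : Fin (G.deg v)) : Fin (G.deg (G.nbr v p)) :=
  (G.port (G.nbr v p)).symm ⟨v, (G.adj_nbr v p).symm⟩

/-- A place: a node together with the port through which it was last entered (`none` if the
robot has never moved). Leaving through port `p` leads to a new place; if there is no port `p`,
the robot stays. -/
def traverse (x : V × Option ℕ) (p : ℕ) : V × Option ℕ :=
  if h : p < G.deg x.1 then (G.nbr x.1 ⟨p, h⟩, some (G.backPort x.1 ⟨p, h⟩ : ℕ)) else x

/-- One step of an exploration sequence: a robot that entered `u` through port `q` leaves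
through port `(q + a) mod deg u`. -/
def uxsStep (x : V × Option ℕ) (a : ℤ) : V × Option ℕ :=
  G.traverse x ((((x.2.getD 0 : ℕ) : ℤ) + a) % (G.deg x.1 : ℤ)).toNat

/-- The nodes seen by a robot that starts at `v`, leaves through port `0` and then follows the
exploration sequence `U`. -/
def uxsVisited (U : List ℤ) (v : V) : List V :=
  v :: (U.scanl G.uxsStep (G.traverse (v, none) 0)).map Prod.fst

/-- Following `U` visits every node, from every starting node. -/
def ExploredBy (U : List ℤ) : Prop := ∀ v w : V, w ∈ G.uxsVisited U v

end PortGraph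

/-- The number of rounds (moves) taken by following the exploration sequence `U`: the initial
move through port `0` and one move for each entry. -/
def uxsRounds (U : List ℤ) : ℕ := U.length + 1

/-- `U` is a universal exploration sequence for the connected graphs of at most `n` nodes. -/
def IsUXS (n : ℕ) (U : List ℤ) : Prop :=
  ∀ (V : Type) [Fintype V] (G : PortGraph V),
    Fintype.card V ≤ n → G.graph.Connected → G.ExploredBy U

/-- What a robot perceives of the node on which it stands. -/
structure LocalView where
  degree : ℕ
  capacity : ℕ
  /-- the port through which the robot last entered, `none` if it has never moved -/
  entry : Option ℕ

/-- What all robots at a node perceive of one robot there in one round: whether it is the shepherd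
(which cannot be faked), the ID it shows, and the message it shouts (`none` is silence). -/
structure Shout (Msg : Type) where
  isShepherd : Bool
  label : ℕ
  msg : Option Msg

/-- What a robot does at the end of a round. -/
inductive Action where
  | stay
  | move (p : ℕ)
  | terminate

/-- A deterministic distributed algorithm for robots with unlimited memory. The shepherd is
given `n`, `k` and its own ID; every other robot is given its own ID and nothing else. In each
round a robot shouts a message determined by its memory and its view of the node, then receives
the shouts of the other robots at its node, updates its memory and acts. -/
structure Algorithm where
  Msg : Type
  Mem : Type
  initShepherd : (n k id : ℕ) → Mem
  initRobot : (id : ℕ) → Mem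
  send : Mem → LocalView → Option Msg
  step : Mem → LocalView → Multiset (Shout Msg) → Mem × Action

/-- A problem instance: a capacitated port-labelled graph with node set `V`, and a set `R` of
robots with distinct IDs and arbitrary initial positions, one of which is the shepherd and some
of which, never the shepherd, are Byzantine. -/
structure Instance (V R : Type) where
  G : PortGraph V
  cap : V → ℕ
  shepherd : R
  id : R → ℕ
  id_injective : Function.Injective id
  byz : Finset R
  shepherd_notMem_byz : shepherd ∉ byz
  start : R → V

/-- What a strong Byzantine robot does in one round: it shows any ID, shouts any message or none,
and stays (`none`) or leaves through a port of its choice. -/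
structure ByzAct (Msg : Type) where
  label : ℕ
  msg : Option Msg
  go : Option ℕ

/-- The status of one robot at the beginning of a round. The fields `mem` and `halted` are
meaningless for Byzantine robots. -/
structure Status (V Mem : Type) where
  place : V × Option ℕ
  mem : Mem
  halted : Bool

namespace Instance

open Classical in
/-- The status of a robot at the start. -/
noncomputable def init {V R : Type} [Fintype V] [Fintype R] (I : Instance V R) (A : Algorithm)
    (r : R) : Status V A.Mem where
  place := (I.start r, none)
  mem := if r = I.shepherd
    then A.initShepherd (Fintype.card V) (Fintype.card R) (I.id r) else A.initRobot (I.id r)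
  halted := false

variable {V R : Type} (I : Instance V R) (A : Algorithm)

/-- The view that a robot at the given place has of its node. -/
def view (x : V × Option ℕ) : LocalView where
  degree := I.G.deg x.1
  capacity := I.cap x.1
  entry := x.2

open Classical in
/-- The shout of robot `r` in a round that begins in configuration `σ` and in which the Byzantine
robots do `β`. A non-Byzantine robot that has terminated is still visible but silent. -/
noncomputable def shout (σ : R → Status V A.Mem) (β : R → ByzAct A.Msg) (r : R) :
    Shout A.Msg :=
  if r ∈ I.byz then ⟨false, (β r).label, (β r).msg⟩
  else ⟨decide (r = I.shepherd), I.id r,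
    if (σ r).halted then none else A.send (σ r).mem (I.view (σ r).place)⟩

open Classical in
/-- The shouts that robot `r` receives: one from each other robot at the same node. -/
noncomputable def received [Fintype R] (σ : R → Status V A.Mem) (β : R → ByzAct A.Msg) (r : R) :
    Multiset (Shout A.Msg) :=
  (Finset.univ.filter fun r' => r' ≠ r ∧ (σ r').place.1 = (σ r).place.1).val.map
    (I.shout A σ β)

/-- The effect of an action of a non-Byzantine robot. -/
def act {Mem : Type} (x : V × Option ℕ) : Mem × Action → Status V Mem
  | (m, .stay) => ⟨x, m, false⟩
  | (m, .move p) => ⟨I.G.traverse x p, m, false⟩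
  | (m, .terminate) => ⟨x, m, true⟩

open Classical in
/-- One synchronous round. A robot that has terminated never moves again. -/
noncomputable def next [Fintype R] (σ : R → Status V A.Mem) (β : R → ByzAct A.Msg) (r : R) :
    Status V A.Mem :=
  if r ∈ I.byz then
    { σ r with place := ((β r).go.map (I.G.traverse (σ r).place)).getD (σ r).place }
  else if (σ r).halted then σ r
  else I.act (σ r).place
    (A.step (σ r).mem (I.view (σ r).place) (I.received A σ β r))

/-- The configuration after `t` rounds when the Byzantine robots behave as in `β`. As the
algorithm is deterministic, the behaviours `β` also cover all adaptive adversaries. -/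
noncomputable def run [Fintype V] [Fintype R] (β : ℕ → R → ByzAct A.Msg) :
    ℕ → R → Status V A.Mem
  | 0 => I.init A
  | t + 1 => I.next A (run β t) (β t)

/-- Byzantine dispersion is achieved: every non-Byzantine robot (including the shepherd) has
terminated, and every node `u` holds at most `cap u` non-Byzantine robots. -/
def Dispersed {Mem : Type} (σ : R → Status V Mem) : Prop :=
  (∀ r, r ∉ I.byz → (σ r).halted = true) ∧
    ∀ u, {r | r ∉ I.byz ∧ (σ r).place.1 = u}.ncard ≤ I.cap u

/-- Whatever the Byzantine robots do, the algorithm achieves Byzantine dispersion within `T`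
rounds. -/
def SolvedWithin [Fintype V] [Fintype R] (T : ℕ) : Prop :=
  ∀ β : ℕ → R → ByzAct A.Msg, ∃ t ≤ T, I.Dispersed (I.run A β t)

end Instance

end Dispersion

/-! Universal sequences exist because there are only finitely many port graphs on `Fin m`, `m ≤ n`,
up to renaming of nodes. Each request "reach `w` from `v`" is met by appending a suffix that starts
wherever the sequence so far ends, and appending never loses a visited node.

For dispersion, all decisions are left to the shepherd. Its flag cannot be forged, so the other
honest robots can obey its orders blindly. The exploration sequence lets it collect them all
(`Gathering.leadAll_uxs`).

The flock then serves as a movable token. The honest robots other than the shepherd are more than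
half of `k - 1`, the Byzantine ones fewer, so a head count alone tells whether the token is at a
node (`Parked.lt_card_received`). To decide whether a port leads to a new node, the token is put
behind it and the shepherd searches the known closed walk (`Parked.probe`). New nodes become detours
in that walk (`IsMap.insert`), which has at most `2n - 2` steps. Probing `n` ports at each of its
steps costs `O(n)` rounds per port, hence `O(n³)` in total (`Parked.explore`).

Finally the shepherd lists the IDs shown around it. The list has fewer than `k` entries and contains
all honest IDs; forged entries only waste slots. Filling the nodes greedily along the walk must
leave a free slot for the shepherd, since the total capacity is at least `k` (`Settling.settle`,
`Settling.tour`). -/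

namespace Dispersion

/-! ### Existence of universal exploration sequences -/

namespace PortGraph

variable {V W : Type} (G : PortGraph V)

theorem nbr_backPort (v : V) (p : Fin (G.deg v)) : G.nbr (G.nbr v p) (G.backPort v p) = v := by
  unfold backPort nbr
  simp

theorem exists_nbr {v w : V} (h : G.graph.Adj v w) : ∃ p, G.nbr v p = w :=
  ⟨(G.port v).symm ⟨w, h⟩, by simp [nbr]⟩

theorem deg_le_card [Fintype V] (v : V) : G.deg v ≤ Fintype.card V := by
  have := Fintype.card_le_of_injective (fun p => (G.port v p).1)
    (Subtype.val_injective.comp (G.port v).injective)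
  simpa using this

/-- Robots at one node may have entered it through different ports. The destination ignores this, so
a flock ordered through one port stays together. -/
theorem traverse_fst_congr {x y : V × Option ℕ} (h : x.1 = y.1) (p : ℕ) :
    (G.traverse x p).1 = (G.traverse y p).1 := by
  obtain ⟨u, a⟩ := x
  obtain ⟨v, b⟩ := y
  obtain rfl : u = v := h
  unfold traverse
  dsimp only
  split_ifs <;> rfl

theorem uxsStep_eq_nbr (x : V × Option ℕ) (p : Fin (G.deg x.1)) :
    ∃ a, (G.uxsStep x a).1 = G.nbr x.1 p := by
  refine ⟨(p : ℤ) - (x.2.getD 0 : ℕ), ?_⟩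
  have h : (((x.2.getD 0 : ℕ) : ℤ) + ((p : ℤ) - (x.2.getD 0 : ℕ))) % (G.deg x.1 : ℤ) = (p : ℕ) := by
    rw [add_sub_cancel]
    exact_mod_cast Nat.mod_eq_of_lt p.2
  unfold uxsStep
  rw [h]
  simp [traverse]

/-- In a connected graph some sequence of steps leads from any place to any node. -/
theorem exists_foldl_uxsStep (hG : G.graph.Connected) (w : V) (x : V × Option ℕ) :
    ∃ U : List ℤ, (U.foldl G.uxsStep x).1 = w := by
  obtain ⟨π⟩ := hG.preconnected x.1 w
  generalize hv : x.1 = v at π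
  induction π generalizing x with
  | nil => exact ⟨[], hv⟩
  | cons h _ ih =>
    subst hv
    obtain ⟨p, hp⟩ := G.exists_nbr h
    obtain ⟨a, ha⟩ := G.uxsStep_eq_nbr x p
    obtain ⟨U, hU⟩ := ih (G.uxsStep x a) (ha.trans hp)
    exact ⟨a :: U, hU⟩

theorem mem_uxsVisited_append_left {U U' : List ℤ} {v w : V} (h : w ∈ G.uxsVisited U v) :
    w ∈ G.uxsVisited (U ++ U') v := by
  simp only [uxsVisited, List.scanl_append, List.map_append, List.mem_cons, List.mem_append] at *
  tauto

theorem foldl_mem_scanl {α β : Type*} (f : β → α → β) (b : β) (l : List α) :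
    l.foldl f b ∈ l.scanl f b := by
  induction l generalizing b with
  | nil => simp
  | cons a l ih => simpa using Or.inr (ih (f b a))

theorem foldl_mem_uxsVisited (U : List ℤ) (v : V) :
    (U.foldl G.uxsStep (G.traverse (v, none) 0)).1 ∈ G.uxsVisited U v :=
  List.mem_cons_of_mem _ (List.mem_map_of_mem (foldl_mem_scanl _ _ _))

/-- Finitely many requests to visit a given node from a given start are met by one sequence. -/
theorem exists_forall_mem_uxsVisited {ι : Type*} {V : ι → Type}
    (l : List (Σ i, PortGraph (V i) × V i × V i)) :
    ∃ U : List ℤ, ∀ x ∈ l, x.2.1.graph.Connected → x.2.2.2 ∈ x.2.1.uxsVisited U x.2.2.1 := by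
  induction l with
  | nil => exact ⟨[], by simp⟩
  | cons x l ih =>
    obtain ⟨U, hU⟩ := ih
    by_cases hx : x.2.1.graph.Connected
    -- The suffix is chosen for the place, entry port included, where `U` leaves this particular
    -- robot.
    · obtain ⟨U', hU'⟩ := x.2.1.exists_foldl_uxsStep hx x.2.2.2
        (U.foldl x.2.1.uxsStep (x.2.1.traverse (x.2.2.1, none) 0))
      refine ⟨U ++ U', fun y hy hc => ?_⟩
      rcases List.mem_cons.1 hy with rfl | hy
      · have := y.2.1.foldl_mem_uxsVisited (U ++ U') y.2.2.1
        rwa [List.foldl_append, hU'] at this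
      · exact y.2.1.mem_uxsVisited_append_left (hU y hy hc)
    · refine ⟨U, fun y hy hc => ?_⟩
      rcases List.mem_cons.1 hy with rfl | hy
      · exact absurd hc hx
      · exact hU y hy hc

/-- The degree function is the only component with an infinite codomain, and the port bijections
bound it by the number of nodes. -/
instance finite [Finite V] : Finite (PortGraph V) := by
  have := Fintype.ofFinite V
  refine Finite.of_surjective
    (α := Σ (g : SimpleGraph V) (d : V → Fin (Fintype.card V + 1)),
      ∀ v, Fin (d v) ≃ g.neighborSet v)
    (fun x => ⟨x.1, fun v => x.2.1 v, x.2.2⟩) fun G => ?_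
  exact ⟨⟨G.graph, fun v => ⟨G.deg v, Nat.lt_succ_of_le (G.deg_le_card v)⟩, G.port⟩, rfl⟩

/-- Compares back ports at nodes that are only propositionally equal, as happens after renaming. -/
theorem val_port_symm_congr {v v' w : V} (hv : v = v') (h : G.graph.Adj v w)
    (h' : G.graph.Adj v' w) :
    ((G.port v).symm ⟨w, h⟩ : ℕ) = (G.port v').symm ⟨w, h'⟩ := by
  subst hv
  rfl

/-- Renaming the nodes. -/
def relabel (e : W ≃ V) : PortGraph W where
  graph := G.graph.comap e
  deg w := G.deg (e w)
  port w := (G.port (e w)).trans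
    { toFun := fun u => ⟨e.symm u, by
        rw [SimpleGraph.mem_neighborSet, SimpleGraph.comap_adj, e.apply_symm_apply]
        exact u.2⟩
      invFun := fun u => ⟨e u, u.2⟩
      left_inv := fun u => by simp
      right_inv := fun u => by simp }

variable (e : W ≃ V)

theorem relabel_traverse (x : W × Option ℕ) (p : ℕ) :
    Prod.map e id ((G.relabel e).traverse x p) = G.traverse (Prod.map e id x) p := by
  by_cases h : p < G.deg (e x.1)
  · have h' : p < (G.relabel e).deg x.1 := h
    have hn : e ((G.relabel e).nbr x.1 ⟨p, h'⟩) = G.nbr (e x.1) ⟨p, h⟩ := by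
      exact e.apply_symm_apply _
    have hb : ((G.relabel e).backPort x.1 ⟨p, h'⟩ : ℕ) = G.backPort (e x.1) ⟨p, h⟩ := by
      exact G.val_port_symm_congr hn _ _
    simp [traverse, h, h', hn, hb]
  · have h' : ¬ p < (G.relabel e).deg x.1 := h
    simp [traverse, h, h']

theorem relabel_uxsStep (x : W × Option ℕ) (a : ℤ) :
    Prod.map e id ((G.relabel e).uxsStep x a) = G.uxsStep (Prod.map e id x) a := by
  simp only [uxsStep, relabel_traverse]
  rfl

theorem relabel_scanl (U : List ℤ) (x : W × Option ℕ) :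
    (U.scanl (G.relabel e).uxsStep x).map (Prod.map e id) = U.scanl G.uxsStep (Prod.map e id x) := by
  induction U generalizing x with
  | nil => simp
  | cons a U ih => simp [ih, relabel_uxsStep]

theorem relabel_uxsVisited (U : List ℤ) (w : W) :
    ((G.relabel e).uxsVisited U w).map e = G.uxsVisited U (e w) := by
  have h := G.relabel_scanl e U ((G.relabel e).traverse (w, none) 0)
  rw [relabel_traverse] at h
  simp only [uxsVisited, List.map_cons, List.map_map]
  rw [show G.traverse (e w, none) 0 = G.traverse (Prod.map e id (w, none)) 0 from rfl, ← h,
    List.map_map]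
  rfl

theorem exploredBy_of_relabel {U : List ℤ} (h : (G.relabel e).ExploredBy U) : G.ExploredBy U := by
  intro v w
  have := List.mem_map_of_mem (f := e) (h (e.symm v) (e.symm w))
  rwa [relabel_uxsVisited, e.apply_symm_apply, e.apply_symm_apply] at this

theorem relabel_connected (h : G.graph.Connected) : (G.relabel e).graph.Connected :=
  (SimpleGraph.Iso.comap e G.graph).connected_iff.2 h

end PortGraph

theorem exists_isUXS (n : ℕ) : ∃ U : List ℤ, IsUXS n U := by
  have := Fintype.ofFinite (Σ m : Fin (n + 1), PortGraph (Fin m) × Fin m × Fin m)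
  obtain ⟨U, hU⟩ := PortGraph.exists_forall_mem_uxsVisited
    (Finset.univ : Finset (Σ m : Fin (n + 1), PortGraph (Fin m) × Fin m × Fin m)).toList
  refine ⟨U, fun V _ G hV hG => ?_⟩
  let e := (Fintype.equivFin V).symm
  refine G.exploredBy_of_relabel e fun v w => ?_
  exact hU ⟨⟨Fintype.card V, Nat.lt_succ_of_le hV⟩, G.relabel e, v, w⟩ (by simp)
    (G.relabel_connected e hG)

end Dispersion

/-! ### The shepherding algorithm and its effect in one round -/

namespace Dispersion

/-- What the shepherd shouts: the robots with the listed IDs settle, and the others at its node,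
if a port is given, leave through it. -/
structure Order where
  settle : List ℕ
  follow : Option ℕ

/-- A program for the shepherd, as a coroutine: the order and the action of a round depend on the
view of the node, the remaining program also on the shouts received in this round. -/
inductive Prog where
  | halt
  | round (cmd : LocalView → Order × Action)
      (next : LocalView → Multiset (Shout Order) → Prog)

/-- The order of the shepherd among the received shouts. -/
noncomputable def heard (M : Multiset (Shout Order)) : Option Order :=
  (M.filter fun s => s.isShepherd = true).toList.head?.bind Shout.msg

/-- The reaction of the robot with the given ID to the order it hears. -/
def obey (id : ℕ) : Option Order → Action
  | none => .stay
  | some o => if id ∈ o.settle then .terminate else (o.follow.map Action.move).getD .stay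

/-- The algorithm in which the shepherd runs a program and the other robots obey its orders. -/
@[reducible]
noncomputable def shepherding (main : ℕ → ℕ → Prog) : Algorithm where
  Msg := Order
  Mem := Prog ⊕ ℕ
  initShepherd n k _ := .inl (main n k)
  initRobot id := .inr id
  send
    | .inl (.round cmd _), v => some (cmd v).1
    | _, _ => none
  step
    | .inl (.round cmd next), v, M => (.inl (next v M), (cmd v).2)
    | .inl .halt, _, _ => (.inl .halt, .terminate)
    | .inr id, _, M => (.inr id, obey id (heard M))

namespace Prog

/-- The shepherd moves through the port chosen by `m`, together with all robots at its node. -/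
def lead (m : LocalView → ℕ) (next : LocalView → Prog) : Prog :=
  .round (fun v => (⟨[], some (m v)⟩, .move (m v))) fun v _ => next v

/-- The shepherd moves alone through the port chosen by `m`. -/
def solo (m : LocalView → ℕ) (next : LocalView → Multiset (Shout Order) → Prog) : Prog :=
  .round (fun v => (⟨[], none⟩, .move (m v))) next

/-- The shepherd leads all robots along a sequence of moves. -/
def leadAll : List (LocalView → ℕ) → Prog → Prog
  | [], next => next
  | m :: ms, next => lead m fun _ => leadAll ms next

end Prog

/-- Port `p`, reduced modulo the degree. -/
def portMod (p : ℕ) (v : LocalView) : ℕ := p % v.degree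

/-- The port that an exploration sequence with entry `a` prescribes. -/
def portUxs (a : ℤ) (v : LocalView) : ℕ :=
  ((((v.entry.getD 0 : ℕ) : ℤ) + a) % (v.degree : ℤ)).toNat

/-- The port of entry. -/
def portBack (v : LocalView) : ℕ := v.entry.getD 0

namespace Instance

variable {V R : Type} [Fintype R] {I : Instance V R} {main : ℕ → ℕ → Prog}

variable (I) in
/-- The shepherd is active at place `x` and about to execute the program `P`; the other
non-Byzantine robots remember their IDs. -/
structure Running (σ : R → Status V (shepherding main).Mem) (P : Prog) (x : V × Option ℕ) :
    Prop where
  mem_shepherd : (σ I.shepherd).mem = .inl P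
  place_shepherd : (σ I.shepherd).place = x
  halted_shepherd : (σ I.shepherd).halted = false
  mem_robot : ∀ r, r ∉ I.byz → r ≠ I.shepherd → (σ r).mem = .inr (I.id r)

variable {σ : R → Status V (shepherding main).Mem} {x : V × Option ℕ} {P : Prog}
  {cmd : LocalView → Order × Action} {nxt : LocalView → Multiset (Shout Order) → Prog}
  {m : LocalView → ℕ} {r : R}

open Classical in
theorem heard_received (h : I.Running σ (.round cmd nxt) x) (β : R → ByzAct Order)
    (hr : r ≠ I.shepherd) :
    heard (I.received (shepherding main) σ β r) =
      if (σ r).place.1 = x.1 then some (cmd (I.view x)).1 else none := by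
  -- The flag of a Byzantine shout is always `false`, so the filter in `heard` retains at most the
  -- genuine order.
  have hsh : ∀ r', (I.shout (shepherding main) σ β r').isShepherd = true ↔ r' = I.shepherd := by
    intro r'
    unfold shout
    by_cases hb : r' ∈ I.byz
    · rw [if_pos hb]
      exact iff_of_false (by simp) fun h' => I.shepherd_notMem_byz (h' ▸ hb)
    · rw [if_neg hb]
      simp
  have hset : (Finset.univ.filter fun r' => r' ≠ r ∧ (σ r').place.1 = (σ r).place.1).filter
      (fun r' => (I.shout (shepherding main) σ β r').isShepherd = true) =
      if (σ r).place.1 = x.1 then {I.shepherd} else ∅ := by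
    ext r'
    split_ifs with hx
    · simp only [hsh, Finset.mem_filter, Finset.mem_univ, true_and, Finset.mem_singleton]
      constructor
      · exact fun h => h.2
      · rintro rfl
        exact ⟨⟨hr.symm, by rw [h.place_shepherd, hx]⟩, rfl⟩
    · simp only [hsh, Finset.mem_filter, Finset.mem_univ, true_and, Finset.notMem_empty,
        iff_false, not_and]
      rintro ⟨-, h1⟩ rfl
      exact hx (by rw [← h1, h.place_shepherd])
  have hfil : (I.received (shepherding main) σ β r).filter (fun s => s.isShepherd = true) =
      (if (σ r).place.1 = x.1 then ({I.shepherd} : Finset R) else ∅).val.map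
        (I.shout (shepherding main) σ β) := by
    rw [← hset]
    unfold received
    rw [Multiset.filter_map, Finset.filter_val]
    congr!
  unfold heard
  rw [hfil]
  split_ifs with hx
  · simp [shout, I.shepherd_notMem_byz, h.halted_shepherd, h.mem_shepherd, h.place_shepherd]
  · simp

/-- A robot that is not at the shepherd's node stays. -/
theorem Running.next_away (h : I.Running σ (.round cmd nxt) x) (β : R → ByzAct Order)
    (hb : r ∉ I.byz) (hr : r ≠ I.shepherd) (hh : (σ r).halted = false)
    (hx : (σ r).place.1 ≠ x.1) :
    (I.next (shepherding main) σ β r).halted = false ∧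
      (I.next (shepherding main) σ β r).place = (σ r).place := by
  simp [next, hb, hh, h.mem_robot r hb hr, heard_received h β hr, hx, obey, act]

/-- A robot at the shepherd's node that is told to settle terminates. -/
theorem Running.next_settle (h : I.Running σ (.round cmd nxt) x) (β : R → ByzAct Order)
    (hb : r ∉ I.byz) (hr : r ≠ I.shepherd) (hh : (σ r).halted = false)
    (hx : (σ r).place.1 = x.1) (hs : I.id r ∈ (cmd (I.view x)).1.settle) :
    (I.next (shepherding main) σ β r).halted = true ∧
      (I.next (shepherding main) σ β r).place = (σ r).place := by
  simp [next, hb, hh, h.mem_robot r hb hr, heard_received h β hr, hx, obey, act, hs]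

/-- A robot at the shepherd's node that is neither told to settle nor to leave stays. -/
theorem Running.next_stay (h : I.Running σ (.round cmd nxt) x) (β : R → ByzAct Order)
    (hb : r ∉ I.byz) (hr : r ≠ I.shepherd) (hh : (σ r).halted = false)
    (hx : (σ r).place.1 = x.1) (hs : I.id r ∉ (cmd (I.view x)).1.settle)
    (hf : (cmd (I.view x)).1.follow = none) :
    (I.next (shepherding main) σ β r).halted = false ∧
      (I.next (shepherding main) σ β r).place = (σ r).place := by
  simp [next, hb, hh, h.mem_robot r hb hr, heard_received h β hr, hx, obey, act, hs, hf]

/-- A robot at the shepherd's node that is not told to settle but to leave does so. -/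
theorem Running.next_follow (h : I.Running σ (.round cmd nxt) x) (β : R → ByzAct Order)
    (hb : r ∉ I.byz) (hr : r ≠ I.shepherd) (hh : (σ r).halted = false)
    (hx : (σ r).place.1 = x.1) (hs : I.id r ∉ (cmd (I.view x)).1.settle) {p : ℕ}
    (hf : (cmd (I.view x)).1.follow = some p) :
    (I.next (shepherding main) σ β r).halted = false ∧
      (I.next (shepherding main) σ β r).place = I.G.traverse (σ r).place p := by
  simp [next, hb, hh, h.mem_robot r hb hr, heard_received h β hr, hx, obey, act, hs, hf]

theorem next_of_halted (β : R → ByzAct Order) (hb : r ∉ I.byz) (hh : (σ r).halted = true) :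
    I.next (shepherding main) σ β r = σ r := by
  simp [next, hb, hh]

theorem Running.mem_robot_next (h : I.Running σ P x) (β : R → ByzAct Order)
    (hb : r ∉ I.byz) (hr : r ≠ I.shepherd) :
    (I.next (shepherding main) σ β r).mem = .inr (I.id r) := by
  by_cases hh : (σ r).halted = true
  · rw [next_of_halted β hb hh, h.mem_robot r hb hr]
  · simp only [next, hb, hh, h.mem_robot r hb hr, if_false]
    cases obey (I.id r) (heard (I.received (shepherding main) σ β r)) <;> rfl

theorem Running.next_shepherd (h : I.Running σ (.round cmd nxt) x) (β : R → ByzAct Order) :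
    I.next (shepherding main) σ β I.shepherd =
      I.act x (.inl (nxt (I.view x) (I.received (shepherding main) σ β I.shepherd)),
        (cmd (I.view x)).2) := by
  simp [next, I.shepherd_notMem_byz, h.mem_shepherd, h.place_shepherd, h.halted_shepherd]

theorem Running.move (h : I.Running σ (.round cmd nxt) x) (β : R → ByzAct Order) {p : ℕ}
    (hp : (cmd (I.view x)).2 = .move p) :
    I.Running (I.next (shepherding main) σ β)
      (nxt (I.view x) (I.received (shepherding main) σ β I.shepherd)) (I.G.traverse x p) := by
  have hs := h.next_shepherd β
  rw [hp] at hs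
  exact ⟨by rw [hs]; rfl, by rw [hs]; rfl, by rw [hs]; rfl, fun r hb hr => h.mem_robot_next β hb hr⟩

theorem Running.stay (h : I.Running σ (.round cmd nxt) x) (β : R → ByzAct Order)
    (hp : (cmd (I.view x)).2 = .stay) :
    I.Running (I.next (shepherding main) σ β)
      (nxt (I.view x) (I.received (shepherding main) σ β I.shepherd)) x := by
  have hs := h.next_shepherd β
  rw [hp] at hs
  exact ⟨by rw [hs]; rfl, by rw [hs]; rfl, by rw [hs]; rfl, fun r hb hr => h.mem_robot_next β hb hr⟩

/-! ### Gathering -/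

variable (I) in
/-- The shepherd leads all robots that started at the nodes in `seen`. -/
structure Gathering (σ : R → Status V (shepherding main).Mem) (P : Prog) (x : V × Option ℕ)
    (seen : Set V) : Prop extends I.Running σ P x where
  robots : ∀ r, r ∉ I.byz → r ≠ I.shepherd →
    (σ r).halted = false ∧ ((σ r).place.1 = x.1 ∨ (σ r).place.1 ∉ seen)

theorem Gathering.lead {next : LocalView → Prog} {seen : Set V}
    (h : I.Gathering σ (.lead m next) x seen) (β : R → ByzAct Order) :
    I.Gathering (I.next (shepherding main) σ β) (next (I.view x))
      (I.G.traverse x (m (I.view x)))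
      (insert (I.G.traverse x (m (I.view x))).1 seen) := by
  have h' : I.Running σ (.round _ _) x := h.toRunning
  refine ⟨h'.move β rfl, fun r hb hr => ?_⟩
  obtain ⟨hh, hp⟩ := h.robots r hb hr
  by_cases hx : (σ r).place.1 = x.1
  · obtain ⟨h1, h2⟩ := h'.next_follow β hb hr hh hx (by simp) rfl
    exact ⟨h1, .inl (by rw [h2]; exact I.G.traverse_fst_congr hx _)⟩
  · obtain ⟨h1, h2⟩ := h'.next_away β hb hr hh hx
    refine ⟨h1, ?_⟩
    rw [h2, Set.mem_insert_iff, not_or]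
    have := hp.resolve_left hx
    tauto

/-- A robot without orders waits at its starting node, so it is collected when the shepherd first
gets there. The `tail` appears because the current node was accounted for on arrival. -/
theorem Gathering.leadAll_uxs [Fintype V] {β : ℕ → R → ByzAct Order} {U : List ℤ} {seen : Set V} {t : ℕ}
    (h : I.Gathering (I.run (shepherding main) β t) (.leadAll (U.map portUxs) P) x seen) :
    ∃ z, I.Gathering (I.run (shepherding main) β (t + U.length)) P z
      (seen ∪ {v | v ∈ ((U.scanl I.G.uxsStep x).map Prod.fst).tail}) := by
  induction U generalizing x seen t with
  | nil => exact ⟨x, by simpa [Prog.leadAll] using h⟩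
  | cons a U ih =>
    have h1 := h.lead (β t)
    obtain ⟨z, hz⟩ := ih (t := t + 1) h1
    refine ⟨z, ?_⟩
    have hstep : I.G.traverse x (portUxs a (I.view x)) = I.G.uxsStep x a := rfl
    rw [hstep] at hz
    have : insert (I.G.uxsStep x a).1 seen ∪
        {v | v ∈ ((U.scanl I.G.uxsStep (I.G.uxsStep x a)).map Prod.fst).tail} =
        seen ∪ {v | v ∈ (((a :: U).scanl I.G.uxsStep x).map Prod.fst).tail} := by
      ext v
      cases U <;> simp [or_assoc, or_left_comm]
    rw [this] at hz
    rwa [List.length_cons, add_comm U.length, ← add_assoc]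

/-! ### The other robots as a token -/

variable (I) in
/-- All non-Byzantine robots other than the shepherd are at `w`. -/
structure Parked (σ : R → Status V (shepherding main).Mem) (P : Prog) (x : V × Option ℕ)
    (w : V) : Prop extends I.Running σ P x where
  robots : ∀ r, r ∉ I.byz → r ≠ I.shepherd → (σ r).halted = false ∧ (σ r).place.1 = w

theorem Parked.lead {next : LocalView → Prog} (h : I.Parked σ (.lead m next) x x.1)
    (β : R → ByzAct Order) :
    I.Parked (I.next (shepherding main) σ β) (next (I.view x))
      (I.G.traverse x (m (I.view x))) (I.G.traverse x (m (I.view x))).1 := by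
  have h' : I.Running σ (.round _ _) x := h.toRunning
  refine ⟨h'.move β rfl, fun r hb hr => ?_⟩
  obtain ⟨hh, hp⟩ := h.robots r hb hr
  obtain ⟨h1, h2⟩ := h'.next_follow β hb hr hh hp (by simp) rfl
  exact ⟨h1, by rw [h2]; exact I.G.traverse_fst_congr hp _⟩

theorem Parked.of_not_follow {w : V} (h : I.Parked σ (.round cmd nxt) x w) (β : R → ByzAct Order)
    (hc : (cmd (I.view x)).1 = ⟨[], none⟩) (hb : r ∉ I.byz) (hr : r ≠ I.shepherd) :
    (I.next (shepherding main) σ β r).halted = false ∧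
      (I.next (shepherding main) σ β r).place.1 = w := by
  obtain ⟨hh, hp⟩ := h.robots r hb hr
  by_cases hx : (σ r).place.1 = x.1
  · obtain ⟨h1, h2⟩ := h.next_stay β hb hr hh hx (by simp [hc]) (by simp [hc])
    exact ⟨h1, by rw [h2, hp]⟩
  · obtain ⟨h1, h2⟩ := h.next_away β hb hr hh hx
    exact ⟨h1, by rw [h2, hp]⟩

theorem Parked.solo {w : V} (h : I.Parked σ (.solo m nxt) x w) (β : R → ByzAct Order) :
    I.Parked (I.next (shepherding main) σ β)
      (nxt (I.view x) (I.received (shepherding main) σ β I.shepherd))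
      (I.G.traverse x (m (I.view x))) w :=
  ⟨h.toRunning.move β rfl, fun _ hb hr => h.of_not_follow β rfl hb hr⟩

/-- The shepherd recognizes the node of the token by the number of robots there. -/
theorem Parked.lt_card_received {w : V} (h : I.Parked σ P x w) (β : R → ByzAct Order)
    (hk : 2 * I.byz.card < Fintype.card R - 1) :
    Fintype.card R - 1 < 2 * (I.received (shepherding main) σ β I.shepherd).card ↔ x.1 = w := by
  classical
  simp only [received, Multiset.card_map, Finset.card_val, h.place_shepherd]
  by_cases hx : x.1 = w
  -- At the token all honest robots are present, and they alone form a strict majority of the `k -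
  -- 1` others.
  · have hsub : (Finset.univ.erase I.shepherd) \ I.byz ⊆
        Finset.univ.filter fun r' => r' ≠ I.shepherd ∧ (σ r').place.1 = x.1 := by
      intro r hr
      simp only [Finset.mem_sdiff, Finset.mem_erase, Finset.mem_univ, and_true] at hr
      simp [hr.1, hx, (h.robots r hr.2 hr.1).2]
    have h1 := Finset.card_le_card hsub
    have h2 := Finset.le_card_sdiff I.byz (Finset.univ.erase I.shepherd)
    rw [Finset.card_erase_of_mem (Finset.mem_univ _), Finset.card_univ] at h2
    simp only [hx, iff_true]
    rw [hx] at h1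
    omega
  -- Elsewhere only Byzantine robots can be met, and they are a minority.
  · have hsub : (Finset.univ.filter fun r' => r' ≠ I.shepherd ∧ (σ r').place.1 = x.1) ⊆
        I.byz := by
      intro r hr
      simp only [Finset.mem_filter, Finset.mem_univ, true_and] at hr
      by_contra hb
      exact hx (hr.2.symm.trans (h.robots r hb hr.1).2)
    have h1 := Finset.card_le_card hsub
    simp only [hx, iff_false]
    omega

end Instance

end Dispersion

namespace Dispersion

/-! ### Walks given by ports -/

namespace PortGraph

variable {V : Type} (G : PortGraph V)

/-- The node reached from `v` through port `p`, reduced modulo the degree. -/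
def go (v : V) (p : ℕ) : V := (G.traverse (v, none) (p % G.deg v)).1

/-- The node reached from `v` by a walk. -/
def walk (v : V) (ps : List ℕ) : V := ps.foldl G.go v

/-- The nodes of a walk from `v`, the last one excluded. -/
def trail : V → List ℕ → List V
  | _, [] => []
  | v, p :: ps => v :: trail (G.go v p) ps

/-- The nodes entered by the marked steps of a walk from `v`. -/
def fresh : V → List (ℕ × Bool) → List V
  | _, [] => []
  | v, (p, true) :: s => G.go v p :: fresh (G.go v p) s
  | v, (p, false) :: s => fresh (G.go v p) s

theorem fst_traverse_mod (x : V × Option ℕ) (p : ℕ) :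
    (G.traverse x (p % G.deg x.1)).1 = G.go x.1 p :=
  G.traverse_fst_congr (x := x) (y := (x.1, none)) rfl _

@[simp] theorem walk_nil (v : V) : G.walk v [] = v := rfl

@[simp] theorem walk_cons (v : V) (p : ℕ) (ps : List ℕ) :
    G.walk v (p :: ps) = G.walk (G.go v p) ps := rfl

@[simp] theorem walk_append (v : V) (ps qs : List ℕ) :
    G.walk v (ps ++ qs) = G.walk (G.walk v ps) qs := List.foldl_append ..

theorem trail_append (v : V) (ps qs : List ℕ) :
    G.trail v (ps ++ qs) = G.trail v ps ++ G.trail (G.walk v ps) qs := by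
  induction ps generalizing v with
  | nil => rfl
  | cons p ps ih => simp [trail, ih]

theorem fresh_append (v : V) (s s' : List (ℕ × Bool)) :
    G.fresh v (s ++ s') = G.fresh v s ++ G.fresh (G.walk v (s.map Prod.fst)) s' := by
  induction s generalizing v with
  | nil => rfl
  | cons b s ih => obtain ⟨p, _ | _⟩ := b <;> simp [fresh, ih]

theorem exists_go_eq_of_adj {v w : V} (h : G.graph.Adj v w) : ∃ p < G.deg v, G.go v p = w := by
  obtain ⟨p, hp⟩ := G.exists_nbr h
  exact ⟨p, p.2, by simp [go, traverse, Nat.mod_eq_of_lt p.2, hp]⟩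

/-- Leaving through the port of entry leads back. -/
theorem go_entry (x : V × Option ℕ) (p : ℕ) :
    G.go (G.go x.1 p) ((G.traverse x (p % G.deg x.1)).2.getD 0) = x.1 := by
  rw [← fst_traverse_mod]
  by_cases h : p % G.deg x.1 < G.deg x.1
  · have ht : G.traverse x (p % G.deg x.1) = (G.nbr x.1 ⟨_, h⟩, some (G.backPort x.1 ⟨_, h⟩ : ℕ)) :=
      dif_pos h
    rw [ht]
    simp [go, traverse, Nat.mod_eq_of_lt (G.backPort x.1 ⟨_, h⟩).2, nbr_backPort]
  -- A port reduced modulo the degree can be missing only at an isolated node, where every move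
  -- stays put.
  · have h0 : G.deg x.1 = 0 := by
      by_contra h0
      exact h (Nat.mod_lt _ (Nat.pos_of_ne_zero h0))
    simp [go, traverse, h0]

/-- A set of nodes that is closed under all ports is everything. -/
theorem mem_of_closed (hG : G.graph.Connected) {N : Set V} {r : V} (hr : r ∈ N)
    (hN : ∀ v ∈ N, ∀ p < G.deg v, G.go v p ∈ N) (w : V) : w ∈ N := by
  obtain ⟨π⟩ := hG.preconnected r w
  induction π with
  | nil => exact hr
  | cons h _ ih =>
    obtain ⟨p, hp, rfl⟩ := G.exists_go_eq_of_adj h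
    exact ih (hN _ hr p hp)

/-- The current knowledge of the shepherd: `A ++ B` is a closed walk from `r` whose marked steps
enter pairwise distinct nodes, all nodes of the walk are entered in this way (or equal `r`), and
all ports at the nodes of `A` (without its end) lead to such nodes. -/
structure IsMap (n : ℕ) (r : V) (A B : List (ℕ × Bool)) : Prop where
  closed : G.walk r ((A ++ B).map Prod.fst) = r
  nodup : (r :: G.fresh r (A ++ B)).Nodup
  trail_subset : G.trail r ((A ++ B).map Prod.fst) ⊆ r :: G.fresh r (A ++ B)
  fresh_subset : G.fresh r (A ++ B) ⊆ G.trail r ((A ++ B).map Prod.fst)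
  length_eq : (A ++ B).length = 2 * (G.fresh r (A ++ B)).length
  probed : ∀ v ∈ G.trail r (A.map Prod.fst), ∀ p < n, G.go v p ∈ r :: G.fresh r (A ++ B)

namespace IsMap

variable {G} {n : ℕ} {r : V} {A B : List (ℕ × Bool)}

/-- Each node other than `r` contributes two steps, one in and one back. -/
theorem length_le [Fintype V] (h : G.IsMap n r A B) : (A ++ B).length + 2 ≤ 2 * Fintype.card V := by
  have := h.nodup.length_le_card
  rw [List.length_cons] at this
  have := h.length_eq
  omega

theorem end_mem (h : G.IsMap n r A B) :
    G.walk r (A.map Prod.fst) ∈ r :: G.fresh r (A ++ B) := by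
  cases B with
  | nil =>
    have := h.closed
    rw [List.append_nil] at this
    rw [this]
    simp
  | cons b B =>
    apply h.trail_subset
    rw [List.map_append, trail_append]
    simp [trail]

/-- The nodes seen on the rotated walk. -/
theorem mem_rotate (h : G.IsMap n r A B) (v : V) :
    v ∈ G.walk r (A.map Prod.fst) :: G.trail (G.walk r (A.map Prod.fst)) ((B ++ A).map Prod.fst) ↔
      v ∈ r :: G.fresh r (A ++ B) := by
  have hc := h.closed
  rw [List.map_append, walk_append] at hc
  -- Rotating a closed walk only permutes its trail. The extra head in the goal matters for the
  -- empty walk, whose trail is empty.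
  have ht : ∀ v, v ∈ G.trail (G.walk r (A.map Prod.fst)) ((B ++ A).map Prod.fst) ↔
      v ∈ G.trail r ((A ++ B).map Prod.fst) := by
    intro v
    rw [List.map_append, List.map_append, trail_append, trail_append, hc,
      List.mem_append, List.mem_append, or_comm]
  rw [List.mem_cons, ht]
  constructor
  · rintro (rfl | hv)
    · exact h.end_mem
    · exact h.trail_subset hv
  · intro hv
    rcases List.mem_cons.1 hv with rfl | hv
    · cases hA : A with
      | nil => exact .inl rfl
      | cons a A => exact .inr (by simp [trail])
    · exact .inr (h.fresh_subset hv)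

theorem walk_rotate (h : G.IsMap n r A B) :
    G.walk (G.walk r (A.map Prod.fst)) ((B ++ A).map Prod.fst) = G.walk r (A.map Prod.fst) := by
  have hc := h.closed
  rw [List.map_append, walk_append] at hc
  rw [List.map_append, walk_append, hc]

/-- The detour through `p` and back through `q` returns to the end of `A`, so `B` continues
unchanged. Placed in front of `B`, the new node will itself be reached when the token advances. -/
theorem insert (h : G.IsMap n r A B) {p q : ℕ}
    (hq : G.go (G.go (G.walk r (A.map Prod.fst)) p) q = G.walk r (A.map Prod.fst))
    (hw : G.go (G.walk r (A.map Prod.fst)) p ∉ r :: G.fresh r (A ++ B)) :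
    G.IsMap n r A ((p, true) :: (q, false) :: B) ∧
      ∀ v, v ∈ r :: G.fresh r (A ++ (p, true) :: (q, false) :: B) ↔
        v = G.go (G.walk r (A.map Prod.fst)) p ∨ v ∈ r :: G.fresh r (A ++ B) := by
  have hend := h.end_mem
  obtain ⟨h1, h2, h3, h4, h5, h6⟩ := h
  simp only [List.map_append, trail_append, fresh_append,
    walk_append] at h1 h2 h3 h4 h5 h6 hw hend
  have hmem : ∀ v, v ∈ r :: G.fresh r (A ++ (p, true) :: (q, false) :: B) ↔
        v = G.go (G.walk r (A.map Prod.fst)) p ∨ v ∈ r :: G.fresh r (A ++ B) := by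
    intro v
    simp only [fresh_append, fresh, hq, List.mem_cons, List.mem_append]
    tauto
  refine ⟨⟨?_, ?_, ?_, ?_, ?_, ?_⟩, hmem⟩
  · simp [hq, h1]
  · have : (r :: G.fresh r (A ++ (p, true) :: (q, false) :: B)).Perm
        (G.go (G.walk r (A.map Prod.fst)) p :: r :: G.fresh r (A ++ B)) := by
      simp only [fresh_append, fresh, hq]
      exact (List.perm_middle.cons r).trans (List.Perm.swap ..)
    rw [this.nodup_iff, List.nodup_cons]
    simp only [fresh_append]
    exact ⟨hw, h2⟩
  · intro v hv
    rw [hmem]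
    simp only [fresh_append]
    simp only [List.map_append, List.map_cons, trail_append, trail, hq,
      List.mem_append, List.mem_cons] at hv
    rcases hv with hv | rfl | rfl | hv
    · exact .inr (h3 (List.mem_append_left _ hv))
    · exact .inr hend
    · exact .inl rfl
    · exact .inr (h3 (List.mem_append_right _ hv))
  · intro v hv
    simp only [fresh_append, fresh, hq, List.mem_append, List.mem_cons] at hv
    simp only [List.map_append, List.map_cons, trail_append, trail, hq,
      List.mem_append, List.mem_cons]
    have := @h4 v
    simp only [List.mem_append] at this
    tauto
  · simp only [fresh_append, fresh, hq]
    simp only [List.length_append, List.length_cons] at h5 ⊢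
    omega
  · intro v hv p' hp'
    rw [hmem]
    simp only [fresh_append]
    exact .inr (h6 v hv p' hp')

theorem advance {b : ℕ × Bool} (h : G.IsMap n r A (b :: B))
    (hp : ∀ p < n, G.go (G.walk r (A.map Prod.fst)) p ∈ r :: G.fresh r (A ++ b :: B)) :
    G.IsMap n r (A ++ [b]) B := by
  have he : A ++ [b] ++ B = A ++ b :: B := by simp
  refine ⟨?_, ?_, ?_, ?_, ?_, ?_⟩ <;> rw [he]
  · exact h.closed
  · exact h.nodup
  · exact h.trail_subset
  · exact h.fresh_subset
  · exact h.length_eq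
  · intro v hv
    rw [List.map_append, trail_append] at hv
    rcases List.mem_append.1 hv with hv | hv
    · exact h.probed v hv
    · obtain rfl : v = G.walk r (A.map Prod.fst) := by simpa [trail] using hv
      exact hp

/-- With `B` exhausted, the known nodes are closed under all ports, and connectivity does the rest.
The root needs `hp`: if `A` is empty, it is not on the trail. -/
theorem complete (hG : G.graph.Connected) (hn : ∀ v, G.deg v ≤ n) (h : G.IsMap n r A [])
    (hp : ∀ p < n, G.go (G.walk r (A.map Prod.fst)) p ∈ r :: G.fresh r (A ++ [])) (w : V) :
    w ∈ r :: G.fresh r A := by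
  have hc := h.closed
  have hfs := h.fresh_subset
  have hpr := h.probed
  rw [List.append_nil] at *
  refine G.mem_of_closed hG (N := {v | v ∈ r :: G.fresh r A}) (r := r) (by simp) ?_ w
  intro v hv p hpv
  rcases List.mem_cons.1 hv with rfl | hv
  · rw [hc] at hp
    exact hp p (hpv.trans_le (hn _))
  · exact hpr v (hfs hv) p (hpv.trans_le (hn _))

end IsMap

theorem isMap_nil (n : ℕ) (r : V) : G.IsMap n r [] [] :=
  ⟨rfl, by simp [fresh], by simp [trail], by simp [fresh], rfl,
    by simp [trail]⟩

end PortGraph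

/-! ### Building the map with the flock as a token -/

namespace Prog

/-- The shepherd walks alone and notes whether it meets more than half of `K` robots. -/
def scout (K : ℕ) : List ℕ → Bool → (Bool → Prog) → Prog
  | [], found, next => next found
  | p :: ps, found, next =>
    solo (portMod p) fun _ M => scout K ps (found || decide (K < 2 * M.card)) next

/-- The token is brought through port `p`; the shepherd inspects the closed walk `W` and fetches
the token back. The result is the port leading back if the token was not found on `W`. -/
def probe (K p : ℕ) (W : List ℕ) (next : Option ℕ → Prog) : Prog :=
  lead (portMod p) fun _ =>
    solo (fun v => portMod (portBack v) v) fun v _ =>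
      scout K (W ++ [p]) false fun found =>
        lead (portMod (portBack v)) fun _ => next (if found then none else some (portBack v))

/-- The listed ports are probed at the end of the walk `A`, where `A ++ B` is a closed walk; the
new nodes are inserted in front of `B`. -/
def probeAll (K : ℕ) (A : List (ℕ × Bool)) :
    List ℕ → List (ℕ × Bool) → (List (ℕ × Bool) → Prog) → Prog
  | [], B, next => next B
  | p :: ps, B, next => probe K p ((B ++ A).map Prod.fst) fun
    | none => probeAll K A ps B next
    | some q => probeAll K A ps ((p, true) :: (q, false) :: B) next

/-- All ports are probed at all nodes of the growing closed walk `A ++ B`, beginning at the end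
of `A`. -/
def explore (K n : ℕ) (next : List (ℕ × Bool) → Prog) :
    ℕ → List (ℕ × Bool) → List (ℕ × Bool) → Prog
  | 0, _, _ => halt
  | fuel + 1, A, B => probeAll K A (List.range n) B fun
    | [] => next A
    | b :: B' => lead (portMod b.1) fun _ => explore K n next fuel (A ++ [b]) B'

end Prog

namespace Instance

variable {V R : Type} [Fintype V] [Fintype R] {I : Instance V R} {main : ℕ → ℕ → Prog}
  {β : ℕ → R → ByzAct Order} {t : ℕ} {x : V × Option ℕ} {w : V}

/-- Leading the token through a port. -/
theorem Parked.lead_mod {p : ℕ} {next : LocalView → Prog}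
    (h : I.Parked (I.run (shepherding main) β t) (.lead (portMod p) next) x x.1) :
    I.Parked (I.run (shepherding main) β (t + 1)) (next (I.view x))
      (I.G.traverse x (p % I.G.deg x.1)) (I.G.go x.1 p) := by
  have := h.lead (β t)
  rwa [show portMod p (I.view x) = p % I.G.deg x.1 from rfl, PortGraph.fst_traverse_mod] at this

theorem Parked.scout (hk : 2 * I.byz.card < Fintype.card R - 1) {ps : List ℕ} {found : Bool}
    {next : Bool → Prog}
    (h : I.Parked (I.run (shepherding main) β t)
      (.scout (Fintype.card R - 1) ps found next) x w) :
    ∃ y : V × Option ℕ, y.1 = I.G.walk x.1 ps ∧ ∃ found' : Bool,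
      (found' = true ↔ found = true ∨ w ∈ I.G.trail x.1 ps) ∧
      I.Parked (I.run (shepherding main) β (t + ps.length)) (next found') y w := by
  induction ps generalizing x found t with
  | nil => exact ⟨x, rfl, found, by simp [PortGraph.trail], h⟩
  | cons p ps ih =>
    have h1 := Parked.solo h (β t)
    have hc := h.lt_card_received (β t) hk
    obtain ⟨y, hy, found', hf, h2⟩ := ih (t := t + 1) h1
    have hx : (I.G.traverse x (portMod p (I.view x))).1 = I.G.go x.1 p := I.G.fst_traverse_mod x p
    rw [hx] at hy hf
    refine ⟨y, hy, found', ?_, ?_⟩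
    · rw [hf, Bool.or_eq_true, decide_eq_true_iff, hc, PortGraph.trail, List.mem_cons, or_assoc,
        eq_comm (a := x.1)]
    · rwa [List.length_cons, add_comm ps.length, ← add_assoc]

/-- Scouting along `W ++ [p]` inspects the trail of `W` and then `x.1`, but not the final node,
where the token waits anyway. Apart from `W`, four moves are made: token out, shepherd back,
shepherd out, token back. -/
theorem Parked.probe (hk : 2 * I.byz.card < Fintype.card R - 1) {p : ℕ} {W : List ℕ}
    {next : Option ℕ → Prog} (hW : I.G.walk x.1 W = x.1)
    (h : I.Parked (I.run (shepherding main) β t)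
      (.probe (Fintype.card R - 1) p W next) x x.1) :
    ∃ y : V × Option ℕ, y.1 = x.1 ∧ ∃ q : ℕ, I.G.go (I.G.go x.1 p) q = x.1 ∧
      ∃ found : Bool, (found = true ↔ I.G.go x.1 p ∈ x.1 :: I.G.trail x.1 W) ∧
      I.Parked (I.run (shepherding main) β (t + (W.length + 4)))
        (next (if found then none else some q)) y x.1 := by
  have h1 := Parked.lead_mod h
  have hq := I.G.go_entry x p
  have hy := I.G.fst_traverse_mod x p
  generalize I.G.traverse x (p % I.G.deg x.1) = y at h1 hq hy
  have h2 := Parked.solo h1 (β (t + 1))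
  have hz : (I.G.traverse y (portMod (portBack (I.view y)) (I.view y))).1 = x.1 := by
    rw [← hq, ← hy]
    exact I.G.fst_traverse_mod y _
  generalize I.G.traverse y (portMod (portBack (I.view y)) (I.view y)) = z at h2 hz
  obtain ⟨y', hy', found, hf, h3⟩ := Parked.scout (t := t + 1 + 1) hk h2
  rw [hz] at hy' hf
  have hy'' : y'.1 = I.G.go x.1 p := by simpa [hW] using hy'
  rw [← hy''] at h3
  have h4 := Parked.lead_mod h3
  have hback : I.G.go y'.1 (portBack (I.view y)) = x.1 := by rw [hy'']; exact hq
  refine ⟨_, (I.G.fst_traverse_mod y' _).trans hback, portBack (I.view y), hq, found, ?_, ?_⟩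
  · rw [hf, PortGraph.trail_append, hW]
    simp only [PortGraph.trail, List.mem_append, List.mem_cons]
    simp [or_comm]
  · rw [hback] at h4
    convert h4 using 2
    simp
    ring

variable {r : V} {n : ℕ}

theorem Parked.probeAll (hk : 2 * I.byz.card < Fintype.card R - 1) {A B : List (ℕ × Bool)}
    {ps : List ℕ} {next : List (ℕ × Bool) → Prog} (hM : I.G.IsMap n r A B)
    (hx : x.1 = I.G.walk r (A.map Prod.fst))
    (h : I.Parked (I.run (shepherding main) β t)
      (.probeAll (Fintype.card R - 1) A ps B next) x x.1) :
    ∃ t' ≤ t + ps.length * (2 * Fintype.card V + 2), ∃ B', I.G.IsMap n r A B' ∧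
      r :: I.G.fresh r (A ++ B) ⊆ r :: I.G.fresh r (A ++ B') ∧
      (∀ p ∈ ps, I.G.go x.1 p ∈ r :: I.G.fresh r (A ++ B')) ∧
      ∃ y : V × Option ℕ, y.1 = x.1 ∧
        I.Parked (I.run (shepherding main) β t') (next B') y y.1 := by
  induction ps generalizing B x t with
  | nil => exact ⟨t, by simp, B, hM, fun _ h => h, by simp, x, rfl, h⟩
  | cons p ps ih =>
    obtain ⟨y, hy, q, hq, found, hf, h1⟩ := Parked.probe hk (by rw [hx, hM.walk_rotate]) h
    rw [hx, hM.mem_rotate] at hf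
    rw [← hy] at h1
    have hlen := hM.length_le
    have hlen' : ((B ++ A).map Prod.fst).length = (A ++ B).length := by simp [add_comm]
    -- The closed walk has at most `2n - 2` steps, and a probe costs four more rounds.
    have hstep : ((B ++ A).map Prod.fst).length + 4 ≤ 2 * Fintype.card V + 2 := by omega
    cases found with
    | true =>
      obtain ⟨t', ht', B', hM', hsub, hps, z, hz, h2⟩ := ih hM (hy.trans hx) h1
      rw [hy] at hz hps
      refine ⟨t', ?_, B', hM', hsub, ?_, z, hz, h2⟩
      · rw [List.length_cons, Nat.succ_mul]
        omega
      · intro p' hp'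
        rcases List.mem_cons.1 hp' with rfl | hp'
        · rw [hx]
          exact hsub (hf.1 rfl)
        · exact hps p' hp'
    | false =>
      rw [hx] at hq
      obtain ⟨hM1, hmem⟩ := hM.insert hq (fun h => by simpa using hf.2 h)
      obtain ⟨t', ht', B', hM', hsub, hps, z, hz, h2⟩ := ih hM1 (hy.trans hx) h1
      rw [hy] at hz hps
      refine ⟨t', ?_, B', hM', ?_, ?_, z, hz, h2⟩
      · rw [List.length_cons, Nat.succ_mul]
        omega
      · exact fun v hv => hsub ((hmem v).2 (.inr hv))
      · intro p' hp'
        rcases List.mem_cons.1 hp' with rfl | hp'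
        · rw [hx]
          exact hsub ((hmem _).2 (.inl rfl))
        · exact hps p' hp'

/-- The walk grows while it is being traversed, but `A` lengthens by one per unit of fuel and the
whole walk stays shorter than `2n`. So `B` is exhausted before the fuel is. -/
theorem Parked.explore (hk : 2 * I.byz.card < Fintype.card R - 1) (hG : I.G.graph.Connected)
    {A B : List (ℕ × Bool)} {fuel : ℕ} {next : List (ℕ × Bool) → Prog}
    (hM : I.G.IsMap (Fintype.card V) r A B) (hx : x.1 = I.G.walk r (A.map Prod.fst))
    (hfuel : fuel + A.length = 2 * Fintype.card V)
    (h : I.Parked (I.run (shepherding main) β t)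
      (.explore (Fintype.card R - 1) (Fintype.card V) next fuel A B) x x.1) :
    ∃ t' ≤ t + fuel * (Fintype.card V * (2 * Fintype.card V + 2) + 1), ∃ A',
      (∀ v, v ∈ r :: I.G.fresh r A') ∧ (r :: I.G.fresh r A').Nodup ∧
      A'.length ≤ 2 * Fintype.card V ∧ ∃ y : V × Option ℕ, y.1 = r ∧
        I.Parked (I.run (shepherding main) β t') (next A') y y.1 := by
  induction fuel generalizing A B x t with
  | zero =>
    have := hM.length_le
    rw [List.length_append] at this
    omega
  | succ fuel ih =>
    obtain ⟨t', ht', B', hM', -, hps, y, hy, h1⟩ := Parked.probeAll hk hM hx h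
    rw [List.length_range] at ht'
    have hps' : ∀ p < Fintype.card V,
        I.G.go (I.G.walk r (A.map Prod.fst)) p ∈ r :: I.G.fresh r (A ++ B') := by
      intro p hp
      rw [← hx]
      exact hps p (List.mem_range.2 hp)
    rw [Nat.succ_mul]
    cases B' with
    | nil =>
      refine ⟨t', by omega, A, hM'.complete hG I.G.deg_le_card hps', ?_, by omega, y, ?_, h1⟩
      · simpa using hM'.nodup
      · rw [hy, hx]
        simpa using hM'.closed
    | cons b B' =>
      have h2 := Parked.lead_mod h1
      have hz := I.G.fst_traverse_mod y b.1
      rw [← hz] at h2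
      obtain ⟨t'', ht'', A', hA'⟩ := ih (hM'.advance hps') (by rw [hz, hy, hx]; simp)
        (by simp; omega) h2
      exact ⟨t'', by omega, A', hA'⟩

end Instance

end Dispersion

/-! ### Settling within the capacities, and the total running time -/

namespace Dispersion

namespace Prog

/-- The first robots of the list `L`, as many as the node can hold, settle. If there is room for
one more, then the shepherd settles, too. -/
def settle (L : List ℕ) (next : List ℕ → Prog) : Prog :=
  .round (fun v => (⟨L.take v.capacity, none⟩,
      if L.length < v.capacity then .terminate else .stay))
    fun v _ => next (L.drop v.capacity)

/-- The robots with IDs in `L` are led along a walk and settle at the nodes entered by the marked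
steps. -/
def tour : List (ℕ × Bool) → List ℕ → Prog
  | [], _ => halt
  | (p, true) :: s, L => lead (portMod p) fun _ => settle L (tour s)
  | (p, false) :: s, L => lead (portMod p) fun _ => tour s L

/-- The shepherd lists the IDs shown at its node. -/
def listLabels (next : List ℕ → Prog) : Prog :=
  .round (fun _ => (⟨[], none⟩, .stay)) fun _ M => next ((M.map Shout.label).sort (· ≤ ·))

/-- The program of the shepherd: gather all robots, explore the graph with them as a token, and
let them settle. -/
def dispersion (U : ℕ → List ℤ) (n k : ℕ) : Prog :=
  leadAll ((fun _ => 0) :: (U n).map portUxs) <|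
    explore (k - 1) n (fun A => listLabels fun L => settle L (tour A)) (2 * n) [] []

end Prog

namespace Instance

variable {V R : Type} [Fintype R] {I : Instance V R} {main : ℕ → ℕ → Prog}
  {σ : R → Status V (shepherding main).Mem} {x : V × Option ℕ} {P : Prog}

variable (I) in
/-- The robots with IDs in `L` are with the shepherd, the others have settled at nodes in `D`
within their capacities. -/
structure Settling (σ : R → Status V (shepherding main).Mem) (P : Prog) (x : V × Option ℕ)
    (L : List ℕ) (D : Finset V) : Prop extends I.Running σ P x where
  robots : ∀ r, r ∉ I.byz → r ≠ I.shepherd →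
    ((σ r).halted = false ∧ (σ r).place.1 = x.1 ∧ I.id r ∈ L) ∨
      ((σ r).halted = true ∧ (σ r).place.1 ∈ D)
  ncard_le : ∀ u, {r | r ∉ I.byz ∧ r ≠ I.shepherd ∧ (σ r).halted = true ∧
    (σ r).place.1 = u}.ncard ≤ I.cap u
  length_add_lt : L.length + ∑ u ∈ D, I.cap u < Fintype.card R

theorem Settling.lead {m : LocalView → ℕ} {next : LocalView → Prog} {L : List ℕ} {D : Finset V}
    (h : I.Settling σ (.lead m next) x L D) (β : R → ByzAct Order) :
    I.Settling (I.next (shepherding main) σ β) (next (I.view x))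
      (I.G.traverse x (m (I.view x))) L D := by
  have h' : I.Running σ (.round _ _) x := h.toRunning
  have key : ∀ r, r ∉ I.byz → r ≠ I.shepherd →
      ((I.next (shepherding main) σ β r).halted = false ∧
        (I.next (shepherding main) σ β r).place.1 = (I.G.traverse x (m (I.view x))).1 ∧
        I.id r ∈ L) ∨
      ((σ r).halted = true ∧ (σ r).place.1 ∈ D ∧ I.next (shepherding main) σ β r = σ r) := by
    intro r hb hr
    rcases h.robots r hb hr with ⟨hh, hp, hL⟩ | ⟨hh, hp⟩
    · obtain ⟨h1, h2⟩ := h'.next_follow β hb hr hh hp (by simp) rfl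
      exact .inl ⟨h1, by rw [h2]; exact I.G.traverse_fst_congr hp _, hL⟩
    · exact .inr ⟨hh, hp, next_of_halted β hb hh⟩
  refine ⟨h'.move β rfl, fun r hb hr => ?_, fun u => ?_, h.length_add_lt⟩
  · rcases key r hb hr with h1 | ⟨h1, h2, h3⟩
    · exact .inl h1
    · rw [h3]
      exact .inr ⟨h1, h2⟩
  · refine (Set.ncard_le_ncard ?_ (Set.toFinite _)).trans (h.ncard_le u)
    rintro r ⟨hb, hr, hh, hp⟩
    rcases key r hb hr with h1 | ⟨h1, -, h3⟩
    · simp [h1.1] at hh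
    · rw [h3] at hh hp
      exact ⟨hb, hr, hh, hp⟩

open Classical in
-- If the list is shorter than the capacity, everyone fits, the shepherd included. Otherwise exactly
-- the capacity of the node is removed from the list, which keeps `L.length + ∑ u ∈ D, I.cap u`
-- constant.
theorem Settling.settle {next : List ℕ → Prog} {L : List ℕ} {D : Finset V}
    (h : I.Settling σ (.settle L next) x L D) (hx : x.1 ∉ D) (β : R → ByzAct Order) :
    I.Dispersed (I.next (shepherding main) σ β) ∨
      I.Settling (I.next (shepherding main) σ β) (next (L.drop (I.cap x.1))) x
        (L.drop (I.cap x.1)) (insert x.1 D) := by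
  have h' : I.Running σ (.round _ _) x := h.toRunning
  have key : ∀ r, r ∉ I.byz → r ≠ I.shepherd →
      ((I.next (shepherding main) σ β r).halted = true ∧
        (I.next (shepherding main) σ β r).place.1 = x.1 ∧ I.id r ∈ L.take (I.cap x.1)) ∨
      ((I.next (shepherding main) σ β r).halted = false ∧
        (I.next (shepherding main) σ β r).place.1 = x.1 ∧ I.id r ∈ L.drop (I.cap x.1)) ∨
      ((σ r).halted = true ∧ (σ r).place.1 ∈ D ∧ I.next (shepherding main) σ β r = σ r) := by
    intro r hb hr
    rcases h.robots r hb hr with ⟨hh, hp, hL⟩ | ⟨hh, hp⟩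
    · by_cases hs : I.id r ∈ L.take (I.cap x.1)
      · obtain ⟨h1, h2⟩ := h'.next_settle β hb hr hh hp hs
        exact .inl ⟨h1, by rw [h2, hp], hs⟩
      · obtain ⟨h1, h2⟩ := h'.next_stay β hb hr hh hp hs rfl
        refine .inr (.inl ⟨h1, by rw [h2, hp], ?_⟩)
        rw [← List.take_append_drop (I.cap x.1) L, List.mem_append] at hL
        exact hL.resolve_left hs
    · exact .inr (.inr ⟨hh, hp, next_of_halted β hb hh⟩)
  have hcount : ∀ u, {r | r ∉ I.byz ∧ r ≠ I.shepherd ∧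
      (I.next (shepherding main) σ β r).halted = true ∧
      (I.next (shepherding main) σ β r).place.1 = u}.ncard ≤
        if u = x.1 then (L.take (I.cap x.1)).length else I.cap u := by
    intro u
    split_ifs with hu
    -- The node is new, so all honest robots settled here come from the current order; true IDs are
    -- distinct, whatever duplicates the list contains.
    · calc _ ≤ ((L.take (I.cap x.1)).toFinset : Set ℕ).ncard :=
            Set.ncard_le_ncard_of_injOn I.id ?_ I.id_injective.injOn (Set.toFinite _)
        _ ≤ _ := by
            rw [Set.ncard_coe_finset]
            exact List.toFinset_card_le _
      rintro r ⟨hb, hr, hh, hp⟩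
      rcases key r hb hr with h1 | h1 | ⟨-, h2, h3⟩
      · simpa using h1.2.2
      · simp [h1.1] at hh
      · rw [h3, hu] at hp
        exact absurd (hp ▸ h2) hx
    · refine (Set.ncard_le_ncard ?_ (Set.toFinite _)).trans (h.ncard_le u)
      rintro r ⟨hb, hr, hh, hp⟩
      rcases key r hb hr with h1 | h1 | ⟨h2, -, h3⟩
      · exact absurd (hp.symm.trans h1.2.1) hu
      · simp [h1.1] at hh
      · rw [h3] at hp
        exact ⟨hb, hr, h2, hp⟩
  by_cases hL : L.length < I.cap x.1
  · left
    have hs := h'.next_shepherd β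
    have hsh : (I.next (shepherding main) σ β I.shepherd).halted = true ∧
        (I.next (shepherding main) σ β I.shepherd).place = x := by
      rw [hs]
      simp [view, hL, act]
    have hall : ∀ r, r ∉ I.byz → r ≠ I.shepherd →
        (I.next (shepherding main) σ β r).halted = true := by
      intro r hb hr
      rcases key r hb hr with h1 | h1 | ⟨h2, -, h3⟩
      · exact h1.1
      · rw [List.drop_eq_nil_of_le hL.le] at h1
        simp at h1
      · rw [h3, h2]
    refine ⟨fun r hb => ?_, fun u => ?_⟩
    · by_cases hr : r = I.shepherd
      · rw [hr, hsh.1]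
      · exact hall r hb hr
    · have hc := hcount u
      by_cases hu : u = x.1
      · rw [if_pos hu, List.take_of_length_le hL.le] at hc
        refine (Set.ncard_le_ncard (t := insert I.shepherd _) ?_ (Set.toFinite _)).trans
          ((Set.ncard_insert_le _ _).trans ((Nat.succ_le_succ hc).trans (by rw [hu]; exact hL)))
        rintro r ⟨hb, hp⟩
        by_cases hr : r = I.shepherd
        · exact .inl hr
        · exact .inr ⟨hb, hr, hall r hb hr, hp⟩
      · rw [if_neg hu] at hc
        refine (Set.ncard_le_ncard ?_ (Set.toFinite _)).trans hc
        rintro r ⟨hb, hp⟩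
        have hr : r ≠ I.shepherd := by
          rintro rfl
          rw [hsh.2] at hp
          exact hu hp.symm
        exact ⟨hb, hr, hall r hb hr, hp⟩
  · right
    refine ⟨h'.stay β (by simp [view, hL]), fun r hb hr => ?_, fun u => ?_, ?_⟩
    · rcases key r hb hr with h1 | h1 | ⟨h1, h2, h3⟩
      · exact .inr ⟨h1.1, by rw [h1.2.1]; exact Finset.mem_insert_self ..⟩
      · exact .inl h1
      · rw [h3]
        exact .inr ⟨h1, Finset.mem_insert_of_mem h2⟩
    · refine (hcount u).trans ?_
      split_ifs with hu
      · rw [hu, List.length_take]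
        exact min_le_left ..
      · exact le_rfl
    · have := h.length_add_lt
      rw [Finset.sum_insert hx, List.length_drop]
      omega

/-- Once all robots are with the shepherd, it can list their IDs. -/
theorem Parked.listLabels {next : List ℕ → Prog}
    (h : I.Parked σ (.listLabels next) x x.1) (β : R → ByzAct Order) :
    ∃ L, I.Settling (I.next (shepherding main) σ β) (next L) x L ∅ := by
  classical
  have h' : I.Parked σ (.round _ _) x x.1 := h
  refine ⟨_, h'.toRunning.stay β rfl, fun r hb hr => ?_, fun u => ?_, ?_⟩
  · obtain ⟨h1, h2⟩ := h'.of_not_follow β rfl hb hr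
    refine .inl ⟨h1, h2, ?_⟩
    rw [Multiset.mem_sort, received, Multiset.map_map, Multiset.mem_map]
    refine ⟨r, ?_, by simp [shout, hb]⟩
    simp [hr, (h.robots r hb hr).2, h.place_shepherd]
  · rw [Set.ncard_eq_zero (Set.toFinite _) |>.2]
    · exact Nat.zero_le _
    · ext r
      simp only [Set.mem_ofPred_eq, Set.mem_empty_iff_false, iff_false]
      rintro ⟨hb, hr, hh, -⟩
      simp [(h'.of_not_follow β rfl hb hr).1] at hh
  · rw [Multiset.length_sort, Multiset.card_map, received, Multiset.card_map, Finset.card_val,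
      Finset.sum_empty, add_zero, ← Finset.card_univ]
    -- The shepherd does not receive its own shout; this gives the strict inequality that later
    -- reserves its slot.
    exact Finset.card_lt_card (Finset.filter_ssubset.2 ⟨I.shepherd, by simp⟩)

variable [Fintype V] {β : ℕ → R → ByzAct Order} {t : ℕ}

/-- The tour cannot end without dispersion: then `D` would be everything and the capacities would
sum to less than the number of robots. A marked step costs two rounds, a move and a settling order.
-/
theorem Settling.tour (hcap : Fintype.card R ≤ ∑ v, I.cap v) {s : List (ℕ × Bool)} {L : List ℕ}
    {D : Finset V} (h : I.Settling (I.run (shepherding main) β t) (.tour s L) x L D)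
    (hs : (I.G.fresh x.1 s).Nodup) (hD : ∀ v ∈ I.G.fresh x.1 s, v ∉ D)
    (hV : ∀ v, v ∈ D ∨ v ∈ I.G.fresh x.1 s) :
    ∃ t' ≤ t + 2 * s.length, I.Dispersed (I.run (shepherding main) β t') := by
  classical
  induction s generalizing x L D t with
  | nil =>
    have hlt := h.length_add_lt
    rw [Finset.eq_univ_of_forall (s := D) fun v => (hV v).resolve_right (by simp [PortGraph.fresh])]
      at hlt
    omega
  | cons b s ih =>
    obtain ⟨p, _ | _⟩ := b
    · have h1 := h.lead (m := portMod p) (β t)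
      have hx : (I.G.traverse x (portMod p (I.view x))).1 = I.G.go x.1 p :=
        I.G.fst_traverse_mod x p
      obtain ⟨t', ht', hd⟩ := ih (t := t + 1) h1 (by rwa [hx]) (by rwa [hx]) (by rwa [hx])
      exact ⟨t', by rw [List.length_cons]; omega, hd⟩
    · have h1 := h.lead (m := portMod p) (β t)
      have hx : (I.G.traverse x (portMod p (I.view x))).1 = I.G.go x.1 p :=
        I.G.fst_traverse_mod x p
      generalize I.G.traverse x (portMod p (I.view x)) = y at h1 hx
      rw [PortGraph.fresh] at hs hD hV
      rw [← hx] at hs hD hV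
      obtain ⟨hy, hs⟩ := List.nodup_cons.1 hs
      rcases h1.settle (hD _ List.mem_cons_self) (β (t + 1)) with hd | h2
      · exact ⟨t + 1 + 1, by rw [List.length_cons]; omega, hd⟩
      · obtain ⟨t', ht', hd⟩ := ih (t := t + 1 + 1) h2 hs
          (fun v hv hvD => by
            rcases Finset.mem_insert.1 hvD with rfl | hvD
            · exact hy hv
            · exact hD v (List.mem_cons_of_mem _ hv) hvD)
          (fun v => by
            have := hV v
            rw [List.mem_cons] at this
            rw [Finset.mem_insert]
            tauto)
        exact ⟨t', by rw [List.length_cons]; omega, hd⟩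

theorem solvedWithin_dispersion (U : ℕ → List ℤ) (hG : I.G.graph.Connected)
    (hU : I.G.ExploredBy (U (Fintype.card V))) (hcap : Fintype.card R ≤ ∑ v, I.cap v)
    (hk : 2 * I.byz.card < Fintype.card R - 1) :
    I.SolvedWithin (shepherding (Prog.dispersion U))
      (16 * (uxsRounds (U (Fintype.card V)) + Fintype.card V ^ 3)) := by
  classical
  intro β
  set n := Fintype.card V with hn
  have hn1 : 1 ≤ n := Fintype.card_pos_iff.2 ⟨I.start I.shepherd⟩
  have h0 : I.Gathering (I.run (shepherding (Prog.dispersion U)) β 0)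
      (Prog.dispersion U n (Fintype.card R)) (I.start I.shepherd, none)
      {I.start I.shepherd} := by
    refine ⟨⟨by simp [run, init, hn], rfl, rfl, fun r _ hr => by simp [run, init, hr]⟩,
      fun r _ _ => ⟨rfl, ?_⟩⟩
    exact em _
  have h1 := h0.lead (β 0)
  obtain ⟨y, h2⟩ := Gathering.leadAll_uxs (t := 1) h1
  have h3 : I.Parked _ _ y y.1 := ⟨h2.toRunning, fun r hb hr => by
    obtain ⟨hh, hp⟩ := h2.robots r hb hr
    refine ⟨hh, hp.resolve_right (not_not.2 ?_)⟩
    generalize (I.run (shepherding (Prog.dispersion U)) β (1 + (U n).length) r).place.1 = w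
    have := hU (I.start I.shepherd) w
    rw [PortGraph.uxsVisited] at this
    revert this
    cases U n <;> simp <;> tauto⟩
  obtain ⟨t3, ht3, A, hA, hnd, hlen, z, hz, h4⟩ :=
    Parked.explore hk hG (I.G.isMap_nil _ y.1) rfl (by simp [hn]) h3
  obtain ⟨L, h5⟩ := h4.listLabels (β t3)
  rw [← hn] at ht3 hlen
  have hbound : uxsRounds (U n) = (U n).length + 1 := rfl
  -- Exploration, then one round each for listing and for settling at the root, then the tour. The
  -- left side is `4n³ + 4n² + 6n + 2`, whose coefficients add up to 16.
  have hpoly : 2 * n * (n * (2 * n + 2) + 1) + 2 + 4 * n ≤ 16 * n ^ 3 := by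
    nlinarith [Nat.pow_le_pow_right hn1 (show 1 ≤ 3 by norm_num),
      Nat.pow_le_pow_right hn1 (show 2 ≤ 3 by norm_num), Nat.one_le_pow 3 n hn1]
  -- The root is entered by no marked step, so it is filled before the tour.
  rcases h5.settle (by simp) (β (t3 + 1)) with hd | h6
  · exact ⟨t3 + 1 + 1, by omega, hd⟩
  · rw [← hz] at hA hnd
    obtain ⟨hy, hs⟩ := List.nodup_cons.1 hnd
    obtain ⟨t', ht', hd⟩ := Settling.tour (t := t3 + 1 + 1) hcap h6 hs
      (fun v hv hvD => by
        rcases Finset.mem_insert.1 hvD with rfl | hvD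
        · exact hy hv
        · simp at hvD)
      (fun v => by
        have := hA v
        rw [List.mem_cons] at this
        rw [Finset.mem_insert]
        tauto)
    exact ⟨t', by omega, hd⟩

end Instance

end Dispersion

theorem theorem1 :
    (∀ n : ℕ, ∃ U : List ℤ, Dispersion.IsUXS n U) ∧
    ∃ C : ℕ, ∀ U : ℕ → List ℤ, ∃ A : Dispersion.Algorithm,
      ∀ (n k f : ℕ) (V R : Type) [Fintype V] [Fintype R] (I : Dispersion.Instance V R),
        Fintype.card V = n → Fintype.card R = k →
        I.G.graph.Connected → I.G.ExploredBy (U n) →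
        k ≤ ∑ v, I.cap v →
        I.byz.card ≤ f → f < (k - 1) / 2 →
        I.SolvedWithin A (C * (Dispersion.uxsRounds (U n) + n ^ 3)) := by
  refine ⟨Dispersion.exists_isUXS, 16, fun U =>
    ⟨Dispersion.shepherding (Dispersion.Prog.dispersion U), ?_⟩⟩
  rintro n k f V R _ _ I rfl rfl hG hU hcap hf hk
  exact I.solvedWithin_dispersion U hG hU hcap (by omega)
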